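/- Let $\mathbb F$ be an algebraically closed field of characteristic zero, let $G$ be a finite group with identity $e$, and let $A=\bigoplus_{g\in G}A_g$ be an associative (not necessarily unital) $G$-graded $\mathbb F$-algebra. For $\bar g=(g_1,\dots,g_n)\in G^n$, $n\ge 1$, let $\mathrm{Sym}(\bar g)$ be the set of permutations $\sigma$ of $\{1,\dots,n\}$ with $g_1\cdots g_n=g_{\sigma(1)}\cdots g_{\sigma(n)}$. The grading is *regular with commutation function $\theta$* if for all $n\ge1$ and $\bar g\in G^n$: (1) for every $\sigma\in \mathrm{Sym}(\bar g)$, $\theta(\bar g,\sigma)\in\mathbb F^\times$ satisfies $a_1\cdots a_n=\theta(\bar g,\sigma)\,a_{\sigma(1)}\cdots a_{\sigma(n)}$ for all $a_i\in A_{g_i}$; (2) there are $a_i\in A_{g_i}$ with $a_1\cdots a_n\neq0$. For commuting $g,h$ write $\theta_{g,h}=\theta((g,h),(1\,2))$. The grading is *nondegenerate* if for every $g\ne e$ there is $h\in C_G(g)$ with $\theta_{g,h}\neq1$. Put $\psi(g)=\theta_{g,g}$. Let $\tau$ be the commutation function of the infinite-dimensional Grassmann algebra graded by $\{\pm1\}$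 (even part in degree $1$, odd part in degree $-1$): $\tau_{-1,-1}=-1$, $\tau_{1,1}=\tau_{1,-1}=\tau_{-1,1}=1$, and $\tau((u_1,\dots,u_n),\sigma)=\prod_{p<q,\ \sigma(p)>\sigma(q)}\tau_{u_{\sigma(p)},u_{\sigma(q)}}$. Let $(\tau\theta)(\bar g,\sigma)=\tau((\psi(g_1),\dots,\psi(g_n)),\sigma)\,\theta(\bar g,\sigma)$. For a $2$-cocycle $\alpha:G\times G\to\mathbb F^\times$ (trivial action), let $\mathbb F^\alpha G$ be the twisted group algebra, with basis $\{U_g\}_{g\in G}$, product $U_gU_h=\alpha(g,h)U_{gh}$, and components $(\mathbb F^\alpha G)_g=\mathbb F U_g$. Suppose that the $G$-grading on $A$ is regular with commutation function $\theta$ and nondegenerate. Then: (i) there is a $2$-cocycle $\alpha:G\times G\to\mathbb F^\times$ such that $\mathbb F^\alpha G$ is regularly $G$-graded with commutation function $\tau\theta$; (ii) for every such $\alpha$, the commutation matrix $M_G\in M_{|G|}(\mathbb F^\alpha G)$, defined by $$(M_G)_{g,h}=\tau_{\psi(g),\psi(h)}\,U_gU_hU_g^{-1}U_h^{-1}\qquad(g,h\in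 G),$$ satisfies $M_G^2=|G|\cdot \mathrm{Id}$. -/

import Mathlib

/-!
Regular gradings by arbitrary finite groups, twisted group algebras and commutation matrices.
-/

namespace RegularGrading

/-- The product `a₀ a₁ ⋯ aₙ` of a nonempty tuple; no unit is needed. -/
def tupleProd {A : Type*} [Mul A] : {n : ℕ} → (Fin (n + 1) → A) → A
  | 0, a => a 0
  | _ + 1, a => a 0 * tupleProd (fun i => a i.succ)

/-- Families of nonzero scalars `θ(ḡ, σ)`, for nonempty tuples `ḡ` of elements of `G` and
permutations `σ`. Only the values at `σ ∈ Sym(ḡ)` (see `IsSym`) are meaningful. -/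
abbrev CommFun (G F : Type*) [Field F] : Type _ :=
  (n : ℕ) → (Fin (n + 1) → G) → Equiv.Perm (Fin (n + 1)) → Fˣ

/-- `σ ∈ Sym(ḡ)`: permuting the entries of `ḡ` by `σ` does not change their product. -/
def IsSym {G : Type*} [Group G] {n : ℕ} (g : Fin (n + 1) → G)
    (σ : Equiv.Perm (Fin (n + 1))) : Prop :=
  tupleProd g = tupleProd (fun i => g (σ i))

/-- `θ_{g,h} = θ((g, h), (1 2))`, meaningful for commuting `g`, `h`. -/
def CommFun.pair {G F : Type*} [Field F] (θ : CommFun G F) (g h : G) : Fˣ :=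
  θ 1 ![g, h] (Equiv.swap 0 1)

/-- The subspaces `𝒜 g` form a regular `G`-grading of the associative (not necessarily unital)
`F`-algebra `A`, with commutation function `θ`. -/
structure IsRegularGrading {G F A : Type*} [Group G] [DecidableEq G] [Field F]
    [NonUnitalRing A] [Module F A] (𝒜 : G → Submodule F A) (θ : CommFun G F) : Prop where
  isInternal : DirectSum.IsInternal 𝒜
  mul_mem : ∀ (g h : G) (a b : A), a ∈ 𝒜 g → b ∈ 𝒜 h → a * b ∈ 𝒜 (g * h)
  commutation : ∀ (n : ℕ) (g : Fin (n + 1) → G) (σ : Equiv.Perm (Fin (n + 1))), IsSym g σ →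
    ∀ a : Fin (n + 1) → A, (∀ i, a i ∈ 𝒜 (g i)) →
      tupleProd a = (θ n g σ : F) • tupleProd (fun i => a (σ i))
  regularity : ∀ (n : ℕ) (g : Fin (n + 1) → G),
    ∃ a : Fin (n + 1) → A, (∀ i, a i ∈ 𝒜 (g i)) ∧ tupleProd a ≠ 0

/-- For every `g ≠ 1` there is `h ∈ C_G(g)` with `θ_{g,h} ≠ 1`. -/
def CommFun.Nondegenerate {G F : Type*} [Group G] [Field F] (θ : CommFun G F) : Prop :=
  ∀ g : G, g ≠ 1 → ∃ h ∈ Subgroup.centralizer {g}, θ.pair g h ≠ 1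

open Classical in
/-- The commutation function of the Grassmann algebra on pairs of degrees, the degrees being
written multiplicatively as `1` (even) and `-1` (odd): `τ(-1,-1) = -1`, and `τ = 1` otherwise. -/
noncomputable def grassmannPair {F : Type*} [Field F] (u v : Fˣ) : Fˣ :=
  if u = -1 ∧ v = -1 then -1 else 1

open Classical in
/-- The commutation function of the infinite dimensional Grassmann algebra on tuples of degrees:
`x₀ ⋯ xₙ = τ(ū, σ) x_{σ(0)} ⋯ x_{σ(n)}` for `xᵢ` homogeneous of degree `uᵢ = ±1`. Every
inversion of `σ` contributes the value of `τ` at the two degrees that are interchanged. -/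
noncomputable def grassmannTuple {F : Type*} [Field F] {n : ℕ} (u : Fin (n + 1) → Fˣ)
    (σ : Equiv.Perm (Fin (n + 1))) : Fˣ :=
  ∏ p, ∏ q, if p < q ∧ σ q < σ p then grassmannPair (u (σ p)) (u (σ q)) else 1

/-- `ψ(g) = θ_{g,g}`. -/
def CommFun.psi {G F : Type*} [Field F] (θ : CommFun G F) (g : G) : Fˣ :=
  θ.pair g g

/-- The function `τθ` (the commutation function of the Grassmann envelope):
`(τθ)(ḡ, σ) = τ((ψ(g₀), …, ψ(gₙ)), σ) θ(ḡ, σ)`. -/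
noncomputable def CommFun.grassmannTwist {G F : Type*} [Field F] (θ : CommFun G F) :
    CommFun G F :=
  fun n g σ => grassmannTuple (fun i => θ.psi (g i)) σ * θ n g σ

/-- 2-cocycles on `G` with values in `Fˣ` (trivial action), not assumed normalized. -/
structure TwoCocycle (G F : Type*) [Group G] [Field F] where
  toFun : G → G → Fˣ
  cocycle : ∀ g h k : G, toFun g h * toFun (g * h) k = toFun h k * toFun g (h * k)

namespace TwoCocycle

variable {G F : Type*} [Group G] [Field F] (α : TwoCocycle G F)

theorem one_left (g : G) : α.toFun 1 g = α.toFun 1 1 := by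
  have h := α.cocycle 1 1 g
  simp only [one_mul] at h
  exact (mul_right_cancel (h.trans (mul_comm _ _) |>.trans (mul_comm _ _))).symm

theorem one_right (g : G) : α.toFun g 1 = α.toFun 1 1 := by
  have h := α.cocycle g 1 1
  simp only [mul_one] at h
  exact mul_right_cancel h

theorem inv_comm (g : G) : α.toFun g g⁻¹ = α.toFun g⁻¹ g := by
  have h := α.cocycle g g⁻¹ g
  simp only [mul_inv_cancel, inv_mul_cancel, one_left, one_right] at h
  exact mul_right_cancel h

end TwoCocycle

/-- The twisted group algebra `F^α G`: the vector space with basis `U_g`, `g ∈ G`, and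
multiplication `U_g U_h = α(g, h) U_{gh}` (see `TwistedGroupAlgebra.U_mul_U`). -/
def TwistedGroupAlgebra {G F : Type*} [Group G] [Field F] (_α : TwoCocycle G F) : Type _ :=
  G →₀ F

namespace TwistedGroupAlgebra

variable {G F : Type*} [Group G] [Field F] (α : TwoCocycle G F)

noncomputable instance : AddCommGroup (TwistedGroupAlgebra α) :=
  inferInstanceAs (AddCommGroup (G →₀ F))

noncomputable instance : Module F (TwistedGroupAlgebra α) :=
  inferInstanceAs (Module F (G →₀ F))

/-- The basis element `U_g`. -/
noncomputable def U (g : G) : TwistedGroupAlgebra α := (Finsupp.single g 1 : G →₀ F)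

/-- The family `U_g` as a basis. -/
noncomputable def basisU : Module.Basis G F (TwistedGroupAlgebra α) :=
  Module.Basis.ofRepr (LinearEquiv.refl F (G →₀ F))

theorem basisU_apply (g : G) : basisU α g = U α g := rfl

/-- The multiplication of `F^α G` as a bilinear map. -/
noncomputable def mulHom :
    TwistedGroupAlgebra α →ₗ[F] TwistedGroupAlgebra α →ₗ[F] TwistedGroupAlgebra α :=
  (basisU α).constr F fun g => (basisU α).constr F fun h => (α.toFun g h : F) • U α (g * h)

noncomputable instance : Mul (TwistedGroupAlgebra α) := ⟨fun x y => mulHom α x y⟩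

noncomputable instance : One (TwistedGroupAlgebra α) :=
  ⟨((α.toFun 1 1)⁻¹ : Fˣ).val • U α 1⟩

theorem mul_def (x y : TwistedGroupAlgebra α) : x * y = mulHom α x y := rfl

theorem one_def : (1 : TwistedGroupAlgebra α) = ((α.toFun 1 1)⁻¹ : Fˣ).val • U α 1 := rfl

theorem U_mul_U (g h : G) : U α g * U α h = (α.toFun g h : F) • U α (g * h) := by
  rw [mul_def, mulHom, ← basisU_apply, ← basisU_apply, Module.Basis.constr_basis,
    Module.Basis.constr_basis]

theorem mulHom_U (g h : G) : mulHom α (U α g) (U α h) = (α.toFun g h : F) • U α (g * h) :=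
  U_mul_U α g h

theorem one_mul_aux (x : TwistedGroupAlgebra α) : 1 * x = x := by
  have : mulHom α 1 = LinearMap.id := by
    refine (basisU α).ext fun g => ?_
    rw [basisU_apply, one_def, map_smul, LinearMap.smul_apply, mulHom_U, smul_smul, one_mul,
      α.one_left g, Units.inv_mul, one_smul, LinearMap.id_apply]
  rw [mul_def, this, LinearMap.id_apply]

theorem mul_one_aux (x : TwistedGroupAlgebra α) : x * 1 = x := by
  have : (mulHom α).flip 1 = LinearMap.id := by
    refine (basisU α).ext fun g => ?_
    rw [basisU_apply, LinearMap.flip_apply, one_def, map_smul, mulHom_U, smul_smul, mul_one,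
      α.one_right g, Units.inv_mul, one_smul, LinearMap.id_apply]
  rw [mul_def, ← LinearMap.flip_apply, this, LinearMap.id_apply]

theorem mul_assoc_aux (x y z : TwistedGroupAlgebra α) : x * y * z = x * (y * z) := by
  have hz : ∀ g h : G, ∀ z, mulHom α (mulHom α (U α g) (U α h)) z
      = mulHom α (U α g) (mulHom α (U α h) z) := by
    intro g h z
    have : mulHom α (mulHom α (U α g) (U α h)) = mulHom α (U α g) ∘ₗ mulHom α (U α h) := by
      refine (basisU α).ext fun k => ?_
      rw [basisU_apply, LinearMap.comp_apply, mulHom_U, mulHom_U, map_smul, map_smul,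
        LinearMap.smul_apply, mulHom_U, mulHom_U, smul_smul, smul_smul, mul_assoc g h k,
        ← Units.val_mul, ← Units.val_mul, α.cocycle]
    rw [this, LinearMap.comp_apply]
  have hy : ∀ g : G, ∀ y z, mulHom α (mulHom α (U α g) y) z
      = mulHom α (U α g) (mulHom α y z) := by
    intro g y z
    have : (mulHom α).flip z ∘ₗ mulHom α (U α g)
        = mulHom α (U α g) ∘ₗ (mulHom α).flip z :=
      (basisU α).ext fun h => hz g h z
    exact LinearMap.congr_fun this y
  have : (mulHom α).flip z ∘ₗ (mulHom α).flip y = (mulHom α).flip (mulHom α y z) :=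
    (basisU α).ext fun g => hy g y z
  exact LinearMap.congr_fun this x

noncomputable instance : Ring (TwistedGroupAlgebra α) :=
  { (inferInstance : AddCommGroup (TwistedGroupAlgebra α)),
    (inferInstance : Mul (TwistedGroupAlgebra α)),
    (inferInstance : One (TwistedGroupAlgebra α)) with
    left_distrib := fun x y z => by simp only [mul_def, map_add]
    right_distrib := fun x y z => by simp only [mul_def, map_add, LinearMap.add_apply]
    zero_mul := fun x => by simp only [mul_def, map_zero, LinearMap.zero_apply]
    mul_zero := fun x => by simp only [mul_def, map_zero]
    mul_assoc := mul_assoc_aux α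
    one_mul := one_mul_aux α
    mul_one := mul_one_aux α }

noncomputable instance : Algebra F (TwistedGroupAlgebra α) :=
  Algebra.ofModule
    (fun r x y => by simp only [mul_def, map_smul, LinearMap.smul_apply])
    (fun r x y => by simp only [mul_def, map_smul])

/-- `U_g` as an invertible element of `F^α G`. -/
noncomputable def unitU (g : G) : (TwistedGroupAlgebra α)ˣ where
  val := U α g
  inv := ((α.toFun 1 1)⁻¹ * (α.toFun g g⁻¹)⁻¹ : Fˣ).val • U α g⁻¹
  val_inv := by
    rw [mul_smul_comm, U_mul_U, smul_smul, ← Units.val_mul, inv_mul_cancel_right,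
      mul_inv_cancel, one_def]
  inv_val := by
    rw [smul_mul_assoc, U_mul_U, smul_smul, ← Units.val_mul, α.inv_comm, inv_mul_cancel_right,
      inv_mul_cancel, one_def]

/-- The natural `G`-grading of `F^α G`: the component of degree `g` is `F U_g`. -/
noncomputable def component (g : G) : Submodule F (TwistedGroupAlgebra α) :=
  Submodule.span F {U α g}

end TwistedGroupAlgebra

/-- The cocycle `α` corresponds to `θ` : the twisted group algebra `F^α G` with its natural
grading is regularly graded with commutation function `τθ`. -/
def IsAssociatedCocycle {G F : Type*} [Group G] [DecidableEq G] [Field F]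
    (θ : CommFun G F) (α : TwoCocycle G F) : Prop :=
  IsRegularGrading (TwistedGroupAlgebra.component α) θ.grassmannTwist

/-- The commutation matrix, with entries
`τ(ψ(g), ψ(h)) U_g U_h U_g⁻¹ U_h⁻¹` in the twisted group algebra `F^α G`. -/
noncomputable def commutationMatrix {G F : Type*} [Group G] [Field F]
    (θ : CommFun G F) (α : TwoCocycle G F) : Matrix G G (TwistedGroupAlgebra α) :=
  fun g h => (grassmannPair (θ.psi g) (θ.psi h) : F) •
    ((TwistedGroupAlgebra.unitU α g * TwistedGroupAlgebra.unitU α h *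
      (TwistedGroupAlgebra.unitU α g)⁻¹ * (TwistedGroupAlgebra.unitU α h)⁻¹ :
        (TwistedGroupAlgebra α)ˣ) : TwistedGroupAlgebra α)

end RegularGrading

set_option linter.unusedSectionVars false

/-! For (i), replace homogeneous elements by formal labels carrying degrees. Regularity makes
monomials in distinct labels generically nonzero, so the scalar relating two orderings of such a
monomial is unique. Exchanging two labels of equal degree `g` costs `ψ(g)`, whatever stands between
them, and `ψ : G → {±1}` is a homomorphism. The Grassmann sign absorbs exactly this cost
(`signedProdRel_swap`). After the correction the scalar depends only on the two words of degrees in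
`G` and no longer on the labels; this is `WordRel`, and on permuted tuples its scalar is `τθ`
(`wordRel_ofFn`).

Words with product `1` commute with all words, with scalar `1`. Scalar multiples of such words,
modulo `WordRel`, therefore form a commutative monoid, and `Fˣ` embeds in its Grothendieck group.
Since `Fˣ` is divisible, the embedding splits, giving a character `χ` of trivial words. Closing an
arbitrary word by the inverse of its product extends `χ`, up to normalization, to a weight `c`, and
`α(g, h) = c [g, h]` is the required cocycle.

For (ii), the entry of `M²` at `(g, gt)` is, up to invertible factors, the signed sum over `h` of
the conjugates `U_h U_t U_h⁻¹`. Replacing `h` by `hz`, with `z` centralizing `t`, multiplies each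
summand by `θ_{z,t}`. Nondegeneracy supplies `z` with `θ_{z,t} ≠ 1` when `t ≠ 1`, so the sum
vanishes. For `t = 1` all `|G|` summands are the same scalar. -/

namespace RegularGrading

/-! ### Monomials in labelled homogeneous elements -/

section LabelledProducts

variable {G F A : Type*} [Group G] [DecidableEq G] [Field F] [NonUnitalRing A] [Module F A]
  [IsScalarTower F A A] [SMulCommClass F A A] {ι κ : Type*}

variable (F) in
/-- The product, in the unitization of `A`, of the elements `a i` along a list of labels. -/
noncomputable def labelProd (a : ι → A) (l : List ι) : Unitization F A :=
  (l.map fun i => (a i : Unitization F A)).prod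

/-- For labels of degrees `d`, the products of homogeneous elements along `l` are `t` times the
products along `l'`. -/
def ProdRel (𝒜 : G → Submodule F A) (d : ι → G) (l l' : List ι) (t : Fˣ) : Prop :=
  ∀ a : ι → A, (∀ i, a i ∈ 𝒜 (d i)) → labelProd F a l = (t : F) • labelProd F a l'

theorem labelProd_nil (a : ι → A) : labelProd F a [] = 1 := rfl

theorem labelProd_cons (a : ι → A) (x : ι) (l : List ι) :
    labelProd F a (x :: l) = (a x : Unitization F A) * labelProd F a l := by
  simp [labelProd]

theorem labelProd_append (a : ι → A) (l l' : List ι) :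
    labelProd F a (l ++ l') = labelProd F a l * labelProd F a l' := by
  simp [labelProd]

theorem labelProd_map (a : κ → A) (f : ι → κ) (l : List ι) :
    labelProd F a (l.map f) = labelProd F (a ∘ f) l := by
  simp [labelProd, Function.comp_def]

theorem labelProd_ofFn (a : ι → A) : ∀ {n : ℕ} (f : Fin (n + 1) → ι),
    labelProd F a (List.ofFn f) = (tupleProd (fun i => a (f i)) : A)
  | 0, f => by simp [List.ofFn_succ, labelProd_cons, labelProd_nil, tupleProd]
  | n + 1, f => by
    rw [List.ofFn_succ, labelProd_cons, labelProd_ofFn a, ← Unitization.inr_mul, tupleProd]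

theorem list_prod_ofFn_eq_tupleProd : ∀ {n : ℕ} (g : Fin (n + 1) → G),
    (List.ofFn g).prod = tupleProd g
  | 0, g => by simp [tupleProd]
  | n + 1, g => by
    rw [List.ofFn_succ, List.prod_cons, list_prod_ofFn_eq_tupleProd, tupleProd]

namespace ProdRel

variable {𝒜 : G → Submodule F A} {d : ι → G} {l l' l'' m m' : List ι} {s t : Fˣ}

theorem refl (𝒜 : G → Submodule F A) (d : ι → G) (l : List ι) : ProdRel 𝒜 d l l 1 := by
  intro a _
  simp

theorem symm (h : ProdRel 𝒜 d l l' t) : ProdRel 𝒜 d l' l t⁻¹ := by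
  intro a ha
  rw [h a ha, smul_smul, Units.inv_mul, one_smul]

theorem trans (h : ProdRel 𝒜 d l l' s) (h' : ProdRel 𝒜 d l' l'' t) :
    ProdRel 𝒜 d l l'' (s * t) := by
  intro a ha
  rw [h a ha, h' a ha, smul_smul, Units.val_mul]

theorem append (h : ProdRel 𝒜 d l l' s) (h' : ProdRel 𝒜 d m m' t) :
    ProdRel 𝒜 d (l ++ m) (l' ++ m') (s * t) := by
  intro a ha
  rw [labelProd_append, labelProd_append, h a ha, h' a ha, smul_mul_smul_comm, Units.val_mul]

theorem cons (x : ι) (h : ProdRel 𝒜 d l l' t) : ProdRel 𝒜 d (x :: l) (x :: l') t := by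
  simpa using (refl 𝒜 d [x]).append h

theorem map (f : ι → κ) {d : κ → G} (h : ProdRel 𝒜 (d ∘ f) l l' t) :
    ProdRel 𝒜 d (l.map f) (l'.map f) t := by
  intro a ha
  rw [labelProd_map, labelProd_map]
  exact h _ fun i => ha (f i)

end ProdRel

/-- Distinctness of the labels identifies each list with its set of entries, and matching equal
labels gives `σ`. This links relations between lists to the tuples in `IsRegularGrading`. -/
theorem exists_ofFn_perm {l l' : List ι} (hl : l.Nodup) (h : l.Perm l') (h0 : l ≠ []) :
    ∃ (n : ℕ) (f : Fin (n + 1) → ι) (σ : Equiv.Perm (Fin (n + 1))),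
      l = List.ofFn f ∧ l' = List.ofFn (f ∘ σ) := by
  classical
  obtain ⟨n, hn⟩ : ∃ n, l.length = n + 1 :=
    ⟨l.length - 1, (Nat.succ_pred_eq_of_pos (List.length_pos_iff.2 h0)).symm⟩
  have hn' : l'.length = n + 1 := h.length_eq ▸ hn
  let e : Fin (n + 1) ≃ {x // x ∈ l} := (finCongr hn.symm).trans hl.getEquiv
  let e' : Fin (n + 1) ≃ {x // x ∈ l'} := (finCongr hn'.symm).trans (h.nodup_iff.1 hl).getEquiv
  let c : {x // x ∈ l'} ≃ {x // x ∈ l} := Equiv.subtypeEquivRight fun x => h.mem_iff.symm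
  refine ⟨n, fun i => e i, (e'.trans c).trans e.symm, ?_, ?_⟩
  · refine List.ext_get (by simp [hn]) fun i h1 h2 => ?_
    simp [-List.ofFn_succ, e]
  · refine List.ext_get (by simp [hn']) fun i h1 h2 => ?_
    simp [-List.ofFn_succ, e', c]

namespace IsRegularGrading

variable {𝒜 : G → Submodule F A} {θ : CommFun G F}

theorem mul_eq_pair_smul (hreg : IsRegularGrading 𝒜 θ) {g h : G} (hgh : g * h = h * g) {x y : A}
    (hx : x ∈ 𝒜 g) (hy : y ∈ 𝒜 h) : x * y = (θ.pair g h : F) • (y * x) := by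
  have := hreg.commutation 1 ![g, h] (Equiv.swap 0 1) (by simpa [IsSym, tupleProd] using hgh)
    ![x, y] (by intro i; fin_cases i <;> simpa)
  simpa [tupleProd, CommFun.pair] using this


/-- With degrees `1, 1, g`, moving the last factor past the product of the first two costs
`θ_{1,g}`, while moving it past each of them separately costs its square. -/
theorem pair_one_left (hreg : IsRegularGrading 𝒜 θ) (g : G) : θ.pair 1 g = 1 := by
  obtain ⟨a, ha, h0⟩ := hreg.regularity 2 ![1, 1, g]
  have h1 : a 0 ∈ 𝒜 1 := ha 0
  have h2 : a 1 ∈ 𝒜 1 := ha 1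
  have h3 : a 2 ∈ 𝒜 g := ha 2
  have h12 : a 0 * a 1 ∈ 𝒜 1 := by simpa using hreg.mul_mem _ _ _ _ h1 h2
  have hc : (1 : G) * g = g * 1 := by simp
  have e0 : tupleProd a = a 0 * (a 1 * a 2) := rfl
  have e1 : a 0 * (a 1 * a 2) = (θ.pair 1 g : F) • (a 2 * (a 0 * a 1)) := by
    rw [← mul_assoc, hreg.mul_eq_pair_smul hc h12 h3]
  have e2 : a 0 * (a 1 * a 2) = (θ.pair 1 g : F) • (θ.pair 1 g : F) • (a 2 * (a 0 * a 1)) := by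
    rw [hreg.mul_eq_pair_smul hc h2 h3, mul_smul_comm, ← mul_assoc,
      hreg.mul_eq_pair_smul hc h1 h3, smul_mul_assoc, mul_assoc]
  have hv : (θ.pair 1 g : F) • (a 2 * (a 0 * a 1)) ≠ 0 := by rwa [← e1, ← e0]
  have e3 := e1.symm.trans e2
  refine Units.ext (smul_left_injective F hv ?_)
  simpa using e3.symm

theorem pair_mul_pair_swap (hreg : IsRegularGrading 𝒜 θ) {g h : G} (hgh : g * h = h * g) :
    θ.pair g h * θ.pair h g = 1 := by
  obtain ⟨a, ha, h0⟩ := hreg.regularity 1 ![g, h]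
  have h1 : a 0 ∈ 𝒜 g := ha 0
  have h2 : a 1 ∈ 𝒜 h := ha 1
  have hv : a 0 * a 1 ≠ 0 := h0
  refine Units.ext (smul_left_injective F hv ?_)
  have := hreg.mul_eq_pair_smul hgh h1 h2
  rw [hreg.mul_eq_pair_smul hgh.symm h2 h1, smul_smul] at this
  simpa using this.symm

theorem psi_mul_self (hreg : IsRegularGrading 𝒜 θ) (g : G) : θ.psi g * θ.psi g = 1 :=
  hreg.pair_mul_pair_swap rfl

theorem exists_labelProd_ne_zero (hreg : IsRegularGrading 𝒜 θ) (d : ι → G) {l : List ι}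
    (hl : l.Nodup) : ∃ a : ι → A, (∀ i, a i ∈ 𝒜 (d i)) ∧ labelProd F a l ≠ 0 := by
  classical
  rcases eq_or_ne l [] with rfl | h0
  · exact ⟨0, fun i => zero_mem _, by simp [labelProd_nil]⟩
  obtain ⟨n, f, -, hf, -⟩ := exists_ofFn_perm hl (List.Perm.refl _) h0
  have hinj : Function.Injective f := List.nodup_ofFn.1 (hf ▸ hl)
  obtain ⟨b, hb, hne⟩ := hreg.regularity n (d ∘ f)
  -- Labels outside `l` receive `0`; they do not occur in the product.
  refine ⟨Function.extend f b 0, fun i => ?_, ?_⟩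
  · by_cases hi : ∃ j, f j = i
    · obtain ⟨j, rfl⟩ := hi
      rw [hinj.extend_apply]
      exact hb j
    · rw [Function.extend_apply' _ _ _ hi]
      exact zero_mem _
  · rw [hf, labelProd_ofFn]
    simp only [hinj.extend_apply]
    intro h
    exact hne (Unitization.inr_injective (R := F) (by simpa using h))

theorem prodRel_unique (hreg : IsRegularGrading 𝒜 θ) {d : ι → G} {l l' : List ι}
    (hl' : l'.Nodup) {s t : Fˣ} (hs : ProdRel 𝒜 d l l' s) (ht : ProdRel 𝒜 d l l' t) : s = t := by
  obtain ⟨a, ha, hne⟩ := hreg.exists_labelProd_ne_zero d hl'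
  exact Units.ext (smul_left_injective F hne ((hs a ha).symm.trans (ht a ha)))

theorem prodRel_ofFn (hreg : IsRegularGrading 𝒜 θ) (d : ι → G) {n : ℕ} (f : Fin (n + 1) → ι)
    (σ : Equiv.Perm (Fin (n + 1))) (h : IsSym (d ∘ f) σ) :
    ProdRel 𝒜 d (List.ofFn f) (List.ofFn (f ∘ σ)) (θ n (d ∘ f) σ) := by
  intro a ha
  rw [labelProd_ofFn, labelProd_ofFn,
    hreg.commutation n (d ∘ f) σ h (fun i => a (f i)) fun i => ha (f i), Unitization.inr_smul]
  rfl

theorem exists_prodRel (hreg : IsRegularGrading 𝒜 θ) {d : ι → G} {l l' : List ι}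
    (hl : l.Nodup) (h : l.Perm l') (hd : (l.map d).prod = (l'.map d).prod) :
    ∃ t, ProdRel 𝒜 d l l' t := by
  rcases eq_or_ne l [] with rfl | h0
  · obtain rfl := h.nil_eq
    exact ⟨1, ProdRel.refl _ _ _⟩
  obtain ⟨n, f, σ, rfl, rfl⟩ := exists_ofFn_perm hl h h0
  refine ⟨_, hreg.prodRel_ofFn d f σ ?_⟩
  rwa [List.map_ofFn, List.map_ofFn, list_prod_ofFn_eq_tupleProd,
    list_prod_ofFn_eq_tupleProd] at hd

theorem prodRel_swap_head (hreg : IsRegularGrading 𝒜 θ) {d : ι → G} {x y : ι} (h : d x = d y)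
    (l : List ι) : ProdRel 𝒜 d (x :: y :: l) (y :: x :: l) (θ.psi (d x)) := by
  intro a ha
  have := hreg.mul_eq_pair_smul rfl (ha x) (h ▸ ha y)
  rw [labelProd_cons, labelProd_cons, labelProd_cons, labelProd_cons, ← mul_assoc, ← mul_assoc,
    ← Unitization.inr_mul, this, Unitization.inr_smul, Unitization.inr_mul, smul_mul_assoc]
  rfl

/-- Exchanging two elements of the same degree `g` in a monomial multiplies it by `ψ(g)`. -/
theorem prodRel_swap (hreg : IsRegularGrading 𝒜 θ) {d : ι → G} {x y : ι} {m : List ι}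
    (hnd : (x :: (m ++ [y])).Nodup) (h : d x = d y) :
    ProdRel 𝒜 d (x :: (m ++ [y])) (y :: (m ++ [x])) (θ.psi (d x)) := by
  classical
  -- The label `none` is a third variable of the same degree as `x` and `y`. It is sent back to `x`
  -- by `f` only at the end, when it no longer occurs.
  let e : Option ι → G := fun o => o.elim (d x) d
  let f : Option ι → ι := fun o => o.elim x id
  obtain ⟨X, hX⟩ : ∃ X, X = some x := ⟨_, rfl⟩
  obtain ⟨Y, hY⟩ : ∃ Y, Y = some y := ⟨_, rfl⟩
  obtain ⟨M, hM⟩ : ∃ M, M = m.map some := ⟨_, rfl⟩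
  have hf : d ∘ f = e := by
    funext o
    cases o <;> rfl
  have heX : e X = d x := by rw [hX]; rfl
  have heY : e Y = d x := by rw [hY, h]; rfl
  have he : e none = d x := rfl
  have hXY : X ≠ Y := by
    rw [hX, hY]
    intro hxy
    simp_all
  have hXn : X ≠ none := by simp [hX]
  have hYn : Y ≠ none := by simp [hY]
  have hMX : ∀ i ∈ M, i ≠ X := by
    rw [hM, hX]
    simp only [List.nodup_cons, List.mem_append, not_or] at hnd
    rintro i hi rfl
    exact hnd.1.1 (by simpa using hi)
  have hMY : ∀ i ∈ M, i ≠ Y := by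
    rw [hM, hY]
    rintro i hi rfl
    have := (List.nodup_append.1 (List.nodup_cons.1 hnd).2).2.2 y (by simpa using hi) y (by simp)
    exact this rfl
  have hMn : ∀ i ∈ M, i ≠ none := by
    rw [hM]
    rintro i hi rfl
    simp at hi
  have hndM : (none :: X :: (M ++ [Y])).Nodup := by
    have : X :: (M ++ [Y]) = (x :: (m ++ [y])).map some := by simp [hX, hY, hM]
    rw [this]
    exact List.nodup_cons.2 ⟨by simp, hnd.map (Option.some_injective _)⟩
  have hp : (X :: (M ++ [Y])).Perm (Y :: (M ++ [X])) :=
    ((List.perm_append_comm (l₁ := M) (l₂ := [Y])).cons X).trans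
      ((List.Perm.swap Y X M).trans ((List.perm_append_comm (l₁ := [X]) (l₂ := M)).cons Y))
  obtain ⟨t, ht⟩ := hreg.exists_prodRel (d := e) (List.nodup_cons.1 hndM).2 hp
    (by simp [heX, heY])
  have hmap : ∀ p q : Option ι, (∀ i ∈ M, i ≠ p) → (∀ i ∈ M, i ≠ q) →
      M.map (Equiv.swap p q) = M := fun p q h1 h2 =>
    (List.map_congr_left fun i hi =>
      Equiv.swap_apply_of_ne_of_ne (h1 i hi) (h2 i hi)).trans (List.map_id' M)
  -- Transposing labels of equal degree preserves the degree map, so the unknown scalar `t` also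
  -- governs exchanges involving `none`.
  have hcomp : ∀ p q : Option ι, e p = e q → e ∘ Equiv.swap p q = e := by
    intro p q hpq
    funext i
    simp only [Function.comp_apply, Equiv.swap_apply_def]
    split_ifs <;> simp_all
  have h3 : ProdRel 𝒜 e (X :: (M ++ [none])) (none :: (M ++ [X])) t := by
    have := ProdRel.map (Equiv.swap Y none) (d := e) (by rwa [hcomp _ _ (heY.trans he.symm)])
      (l := X :: (M ++ [Y])) (l' := Y :: (M ++ [X])) (t := t)
    simpa [hmap _ _ hMY hMn, Equiv.swap_apply_of_ne_of_ne hXY hXn] using this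
  have h2 : ProdRel 𝒜 e (none :: (M ++ [Y])) (Y :: (M ++ [none])) t := by
    have := ProdRel.map (Equiv.swap X none) (d := e) (by rwa [hcomp _ _ (heX.trans he.symm)])
      (l := X :: (M ++ [Y])) (l' := Y :: (M ++ [X])) (t := t)
    simpa [hmap _ _ hMX hMn, Equiv.swap_apply_of_ne_of_ne hXY.symm hYn] using this
  have c1 := hreg.prodRel_swap_head (he.trans heX.symm) (M ++ [Y])
  have c2 := hreg.prodRel_swap_head (heX.trans heY.symm) (M ++ [none])
  have c3 := hreg.prodRel_swap_head (heY.trans he.symm) (M ++ [X])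
  -- A second route from `none X M Y` to `none Y M X`, alternating three adjacent swaps with two
  -- long exchanges. Comparison with the direct route gives `t = ψ³ t²`, hence `t = ψ` because `ψ² =
  -- 1`.
  have hc := c1.trans ((h2.cons X).trans (c2.trans ((h3.cons Y).trans c3)))
  have hnd' : (none :: Y :: (M ++ [X])).Nodup := (hp.cons none).nodup_iff.1 hndM
  have key := hreg.prodRel_unique hnd' (ht.cons none) hc
  rw [he, heX, heY] at key
  have hsq := hreg.psi_mul_self (d x)
  have ht' : t = θ.psi (d x) := by
    have h1 : t * θ.psi (d x) = 1 := by
      have : t * 1 = t * (t * θ.psi (d x) * (θ.psi (d x) * θ.psi (d x))) := by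
        rw [mul_one]
        refine key.trans ?_
        ac_rfl
      rw [hsq, mul_one (t * θ.psi (d x))] at this
      exact (mul_left_cancel this).symm
    calc t = t * (θ.psi (d x) * θ.psi (d x)) := by rw [hsq, mul_one]
      _ = θ.psi (d x) := by rw [← mul_assoc, h1, one_mul]
  have := ProdRel.map f (d := d) (l := X :: (M ++ [Y])) (l' := Y :: (M ++ [X])) (t := t)
    (by rwa [hf])
  simpa [hX, hY, hM, f, ht', Function.comp_def] using this

/-- In a monomial of degrees `g, h, g, h`, exchanging the two blocks `gh` amounts to exchanging the
two `g`'s and then the two `h`'s. -/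
theorem psi_mul (hreg : IsRegularGrading 𝒜 θ) (g h : G) :
    θ.psi (g * h) = θ.psi g * θ.psi h := by
  let d : Fin 4 → G := ![g, h, g, h]
  have h1 : ProdRel 𝒜 d [0, 1, 2, 3] [2, 1, 0, 3] (θ.psi g) := by
    simpa [d] using (hreg.prodRel_swap (d := d) (x := 0) (y := 2) (m := [1]) (by decide)
      rfl).append (ProdRel.refl 𝒜 d [3])
  have h2 : ProdRel 𝒜 d [2, 1, 0, 3] [2, 3, 0, 1] (θ.psi h) :=
    (hreg.prodRel_swap (d := d) (x := 1) (y := 3) (m := [0]) (by decide) rfl).cons 2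
  have h3 : ProdRel 𝒜 d [0, 1, 2, 3] [2, 3, 0, 1] (θ.psi (g * h)) := by
    intro a ha
    have := hreg.mul_eq_pair_smul rfl (hreg.mul_mem g h _ _ (ha 0) (ha 1))
      (hreg.mul_mem g h _ _ (ha 2) (ha 3))
    have e := congrArg (fun z : A => (z : Unitization F A)) this
    simpa [labelProd, mul_assoc, CommFun.psi] using e
  exact hreg.prodRel_unique (by decide) h3 (h1.trans h2)

theorem prodRel_comm_of_prod_eq_one (hreg : IsRegularGrading 𝒜 θ) {d : ι → G} {l : List ι}
    (hl : (l.map d).prod = 1) (l' : List ι) : ProdRel 𝒜 d (l ++ l') (l' ++ l) 1 := by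
  -- Nonempty lists only: the empty product lies in the unitization, not in `A`.
  have hmem : ∀ a : ι → A, (∀ i, a i ∈ 𝒜 (d i)) → ∀ l : List ι, l ≠ [] →
      ∃ z ∈ 𝒜 (l.map d).prod, labelProd F a l = (z : Unitization F A) := by
    intro a ha l
    induction l with
    | nil => simp
    | cons x l ih =>
      intro _
      rcases eq_or_ne l [] with rfl | h0
      · exact ⟨a x, by simpa using ha x, by simp [labelProd]⟩
      · obtain ⟨z, hz, hz'⟩ := ih h0
        exact ⟨a x * z, by simpa using hreg.mul_mem _ _ _ _ (ha x) hz,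
          by rw [labelProd_cons, hz', Unitization.inr_mul]⟩
  rcases eq_or_ne l [] with rfl | h0
  · simpa using ProdRel.refl 𝒜 d l'
  rcases eq_or_ne l' [] with rfl | h0'
  · simpa using ProdRel.refl 𝒜 d l
  intro a ha
  obtain ⟨z, hz, hz'⟩ := hmem a ha l h0
  obtain ⟨y, hy, hy'⟩ := hmem a ha l' h0'
  rw [hl] at hz
  rw [labelProd_append, labelProd_append, hz', hy', ← Unitization.inr_mul, ← Unitization.inr_mul,
    hreg.mul_eq_pair_smul (by simp) hz hy, hreg.pair_one_left]
  simp

end IsRegularGrading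

end LabelledProducts

/-! ### Grassmann signs of lists -/

section Signs

variable {F : Type*} [Field F]

theorem grassmannPair_comm (u v : Fˣ) : grassmannPair u v = grassmannPair v u := by
  by_cases hu : u = -1 <;> by_cases hv : v = -1 <;> simp [grassmannPair, hu, hv]

theorem grassmannPair_mul_self (u v : Fˣ) : grassmannPair u v * grassmannPair u v = 1 := by
  unfold grassmannPair
  split_ifs <;> simp

theorem grassmannPair_one_left (v : Fˣ) : grassmannPair 1 v = 1 := by
  unfold grassmannPair
  split_ifs with h
  · exact h.1.symm
  · rfl

theorem units_eq_one_or_neg_one {u : Fˣ} (hu : u * u = 1) : u = 1 ∨ u = -1 := by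
  rcases mul_self_eq_one_iff.1 (show (u : F) * u = 1 by rw [← Units.val_mul, hu, Units.val_one]) with h | h
  · exact Or.inl (Units.ext h)
  · exact Or.inr (Units.ext (by simpa using h))

theorem grassmannPair_self {u : Fˣ} (hu : u * u = 1) : grassmannPair u u = u := by
  rcases units_eq_one_or_neg_one hu with rfl | rfl
  · exact grassmannPair_one_left _
  · simp [grassmannPair]

theorem grassmannPair_mul_left {u v : Fˣ} (hu : u * u = 1) (hv : v * v = 1) (w : Fˣ) :
    grassmannPair (u * v) w = grassmannPair u w * grassmannPair v w := by
  rcases units_eq_one_or_neg_one hu with rfl | rfl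
  · rw [grassmannPair_one_left, one_mul, one_mul]
  rcases units_eq_one_or_neg_one hv with rfl | rfl
  · rw [grassmannPair_one_left, mul_one, mul_one]
  rw [grassmannPair_mul_self, hu, grassmannPair_one_left]

variable {ι κ : Type*} [LinearOrder ι] [LinearOrder κ] (u : ι → Fˣ)

/-- The sign contributed by `x` standing before `y`. -/
noncomputable def inversionSign (x y : ι) : Fˣ :=
  if y < x then grassmannPair (u x) (u y) else 1

/-- The product of the signs of all inversions of a list. -/
noncomputable def listSign : List ι → Fˣ
  | [] => 1
  | x :: l => (l.map (inversionSign u x)).prod * listSign l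

/-- The product of the signs of all inversions between two consecutive lists. -/
noncomputable def crossSign (l l' : List ι) : Fˣ :=
  (l.map fun x => (l'.map (inversionSign u x)).prod).prod

theorem inversionSign_mul_self (x y : ι) : inversionSign u x y * inversionSign u x y = 1 := by
  unfold inversionSign
  split_ifs
  · exact grassmannPair_mul_self _ _
  · simp

theorem inversionSign_mul_swap {x y : ι} (h : x ≠ y) :
    inversionSign u x y * inversionSign u y x = grassmannPair (u x) (u y) := by
  unfold inversionSign
  rcases lt_or_gt_of_ne h with h | h
  · rw [if_neg h.not_gt, if_pos h, one_mul, grassmannPair_comm]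
  · rw [if_pos h, if_neg h.not_gt, mul_one]

theorem list_prod_map_mul_self {α M : Type*} [CommMonoid M] (f : α → M)
    (hf : ∀ x, f x * f x = 1) (l : List α) : (l.map f).prod * (l.map f).prod = 1 := by
  rw [← List.prod_map_mul]
  simp [hf]

theorem list_prod_map_comm {α β M : Type*} [CommMonoid M] (f : α → β → M) (l : List α)
    (l' : List β) : (l.map fun x => (l'.map fun y => f x y).prod).prod =
      (l'.map fun y => (l.map fun x => f x y).prod).prod := by
  induction l with
  | nil => simp
  | cons x l ih => simp [ih, List.prod_map_mul]

theorem listSign_mul_self : ∀ l : List ι, listSign u l * listSign u l = 1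
  | [] => by simp [listSign]
  | x :: l => by
    rw [listSign, mul_mul_mul_comm, listSign_mul_self l,
      list_prod_map_mul_self _ (inversionSign_mul_self u x), one_mul]

theorem crossSign_mul_self (l l' : List ι) : crossSign u l l' * crossSign u l l' = 1 :=
  list_prod_map_mul_self _ (fun x => list_prod_map_mul_self _ (inversionSign_mul_self u x) l') l

theorem listSign_append (l l' : List ι) :
    listSign u (l ++ l') = listSign u l * listSign u l' * crossSign u l l' := by
  induction l with
  | nil => simp [listSign, crossSign]
  | cons x l ih =>
    have : crossSign u (x :: l) l' = (l'.map (inversionSign u x)).prod * crossSign u l l' := by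
      simp [crossSign]
    rw [List.cons_append, listSign, ih, listSign, this, List.map_append, List.prod_append]
    ac_rfl

theorem crossSign_perm {l m l' m' : List ι} (h : l.Perm m) (h' : l'.Perm m') :
    crossSign u l l' = crossSign u m m' := by
  unfold crossSign
  rw [(h.map _).prod_eq]
  congr 1
  exact List.map_congr_left fun x _ => (h'.map _).prod_eq

/-- Each pair of distinct labels is inverted in exactly one of the two relative orders. -/
theorem crossSign_mul_swap {l l' : List ι} (h : ∀ x ∈ l, ∀ y ∈ l', x ≠ y) :
    crossSign u l l' * crossSign u l' l =
      (l.map fun x => (l'.map fun y => grassmannPair (u x) (u y)).prod).prod := by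
  induction l with
  | nil => simp [crossSign]
  | cons x l ih =>
    have h1 : crossSign u (x :: l) l' = (l'.map (inversionSign u x)).prod * crossSign u l l' := by
      simp [crossSign]
    have h2 : crossSign u l' (x :: l) =
        (l'.map fun y => inversionSign u y x).prod * crossSign u l' l := by
      simp [crossSign, List.prod_map_mul]
    rw [h1, h2, mul_mul_mul_comm, ih fun z hz => h z (List.mem_cons_of_mem _ hz), List.map_cons,
      List.prod_cons, ← List.prod_map_mul]
    congr 2
    exact List.map_congr_left fun y hy =>
      inversionSign_mul_swap u (h x List.mem_cons_self y hy)

theorem listSign_swap_head_mul {p q : ι} (hpq : p ≠ q) (m : List ι) :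
    listSign u (p :: q :: m) * listSign u (q :: p :: m) = grassmannPair (u p) (u q) := by
  have h1 := list_prod_map_mul_self _ (inversionSign_mul_self u p) m
  have h2 := list_prod_map_mul_self _ (inversionSign_mul_self u q) m
  have h3 := listSign_mul_self u m
  rw [← inversionSign_mul_swap u hpq]
  simp only [listSign, List.map_cons, List.prod_cons]
  calc _ = (inversionSign u p q * inversionSign u q p) *
        ((m.map (inversionSign u p)).prod * (m.map (inversionSign u p)).prod) *
        ((m.map (inversionSign u q)).prod * (m.map (inversionSign u q)).prod) *
        (listSign u m * listSign u m) := by ac_rfl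
    _ = _ := by rw [h1, h2, h3, mul_one, mul_one, mul_one]

/-- The relative sign of two orderings does not depend on the linear order chosen on the labels, so
`f` need not be monotone: an adjacent swap contributes the same `grassmannPair` for either order. -/
theorem listSign_map_mul {f : κ → ι} {l l' : List κ} (h : l.Perm l') (hl : (l.map f).Nodup) :
    listSign u (l.map f) * listSign u (l'.map f) =
      listSign (u ∘ f) l * listSign (u ∘ f) l' := by
  induction h with
  | nil => simp [listSign]
  | @cons x l l' h ih =>
    simp only [List.map_cons, listSign] at hl ⊢
    rw [mul_mul_mul_comm, ih (List.nodup_cons.1 hl).2, ((h.map f).map _).prod_eq,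
      (h.map (inversionSign (u ∘ f) x)).prod_eq,
      list_prod_map_mul_self _ (inversionSign_mul_self u (f x)), mul_mul_mul_comm,
      list_prod_map_mul_self _ (inversionSign_mul_self (u ∘ f) x)]
  | swap x y l =>
    have hne : f y ≠ f x := by
      simp only [List.map_cons, List.nodup_cons, List.mem_cons, not_or] at hl
      exact hl.1.1
    have hne' : y ≠ x := fun h => hne (congrArg f h)
    rw [List.map_cons, List.map_cons, List.map_cons, List.map_cons]
    exact (listSign_swap_head_mul u hne _).trans (listSign_swap_head_mul (u ∘ f) hne' _).symm
  | @trans l l' l'' h h' ih ih' =>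
    have hl' : (l'.map f).Nodup := (h.map f).nodup_iff.1 hl
    have e1 := ih hl
    have e2 := ih' hl'
    calc _ = (listSign u (l.map f) * listSign u (l'.map f)) *
          (listSign u (l'.map f) * listSign u (l''.map f)) := by
          rw [mul_assoc, ← mul_assoc (listSign u (l'.map f)), listSign_mul_self, one_mul]
      _ = _ := by
        rw [e1, e2, mul_assoc, ← mul_assoc (listSign (u ∘ f) l'), listSign_mul_self, one_mul]

theorem listSign_ofFn : ∀ {n : ℕ} (f : Fin n → ι), listSign u (List.ofFn f) =
    ∏ p, ∏ q, if p < q then inversionSign u (f p) (f q) else 1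
  | 0, f => by simp [listSign]
  | n + 1, f => by
    rw [List.ofFn_succ, listSign, listSign_ofFn, Fin.prod_univ_succ, List.map_ofFn, List.prod_ofFn]
    congr 1
    · rw [Fin.prod_univ_succ]
      simp
    · refine Finset.prod_congr rfl fun p _ => ?_
      rw [Fin.prod_univ_succ]
      simp [Fin.succ_lt_succ_iff]

theorem listSign_ofFn_perm {n : ℕ} (u : Fin (n + 1) → Fˣ) (σ : Equiv.Perm (Fin (n + 1))) :
    listSign u (List.ofFn σ) = grassmannTuple u σ := by
  rw [listSign_ofFn, grassmannTuple]
  refine Finset.prod_congr rfl fun p _ => Finset.prod_congr rfl fun q _ => ?_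
  rw [inversionSign, ite_and]

theorem listSign_finRange {n : ℕ} (u : Fin n → Fˣ) : listSign u (List.ofFn id) = 1 := by
  rw [listSign_ofFn]
  refine Finset.prod_eq_one fun p _ => Finset.prod_eq_one fun q _ => ?_
  rw [inversionSign]
  split_ifs with h h'
  · exact absurd h' h.not_gt
  · rfl
  · rfl

/-- Passing `x` and `y` across `m` contributes the same sign twice, since their parities agree; only
the pair `x, y` itself remains. -/
theorem listSign_swap_mul {x y : ι} {m : List ι} (hnd : (x :: (m ++ [y])).Nodup)
    (h : u x = u y) : listSign u (x :: (m ++ [y])) * listSign u (y :: (m ++ [x])) =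
      grassmannPair (u x) (u y) := by
  simp only [List.nodup_cons, List.mem_append, List.mem_singleton, not_or, List.nodup_append] at hnd
  obtain ⟨⟨hxm, hxy⟩, -, -, hmy⟩ := hnd
  have h1 := crossSign_mul_swap u (l := [x]) (l' := m)
    (fun a ha b hb hab => hxm (by rw [List.mem_singleton] at ha; rwa [← ha, hab]))
  have h2 := crossSign_mul_swap u (l := [y]) (l' := m)
    (fun a ha b hb hab => hmy b hb y rfl (by rw [List.mem_singleton] at ha; rw [← ha, hab]))
  have h3 := list_prod_map_mul_self (fun z => grassmannPair (u x) (u z))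
    (fun z => grassmannPair_mul_self _ _) m
  have hS := listSign_mul_self u m
  have hX : (m.map (inversionSign u x)).prod = crossSign u [x] m := by simp [crossSign]
  have hY : (m.map (inversionSign u y)).prod = crossSign u [y] m := by simp [crossSign]
  rw [← inversionSign_mul_swap u hxy]
  simp only [listSign, listSign_append, List.map_append, List.prod_append, hX, hY, List.map_cons,
    List.map_nil, List.prod_cons, List.prod_nil, mul_one] at h1 h2 ⊢
  rw [← h] at h2
  calc _ = (inversionSign u x y * inversionSign u y x) *
        ((crossSign u [x] m * crossSign u m [x]) * (crossSign u [y] m * crossSign u m [y])) *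
        (listSign u m * listSign u m) := by ac_rfl
    _ = _ := by rw [h1, h2, h3, hS, mul_one, mul_one]

end Signs

/-! ### Signed relations and words of degrees -/

section Words

variable {G F A : Type*} [Group G] [DecidableEq G] [Field F] [NonUnitalRing A] [Module F A]
  [IsScalarTower F A A] [SMulCommClass F A A]

/-- The relation `ProdRel` corrected by the Grassmann sign of the permutation. -/
def SignedProdRel {ι : Type*} [LinearOrder ι] (𝒜 : G → Submodule F A) (θ : CommFun G F)
    (d : ι → G) (l l' : List ι) (t : Fˣ) : Prop :=
  ProdRel 𝒜 d l l' (t * (listSign (θ.psi ∘ d) l * listSign (θ.psi ∘ d) l'))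

namespace SignedProdRel

variable {ι : Type*} [LinearOrder ι] {𝒜 : G → Submodule F A} {θ : CommFun G F} {d : ι → G}
  {l l' l'' m m' : List ι} {s t : Fˣ}

theorem refl (𝒜 : G → Submodule F A) (θ : CommFun G F) (d : ι → G) (l : List ι) :
    SignedProdRel 𝒜 θ d l l 1 := by
  rw [SignedProdRel, listSign_mul_self, one_mul]
  exact ProdRel.refl _ _ _

theorem symm (h : SignedProdRel 𝒜 θ d l l' t) : SignedProdRel 𝒜 θ d l' l t⁻¹ := by
  have := ProdRel.symm h
  have e : ∀ l : List ι, (listSign (θ.psi ∘ d) l)⁻¹ = listSign (θ.psi ∘ d) l := fun l =>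
    inv_eq_of_mul_eq_one_left (listSign_mul_self _ l)
  rwa [mul_inv, mul_inv, e, e, mul_comm (listSign _ l)] at this

theorem trans (h : SignedProdRel 𝒜 θ d l l' s) (h' : SignedProdRel 𝒜 θ d l' l'' t) :
    SignedProdRel 𝒜 θ d l l'' (s * t) := by
  have := ProdRel.trans h h'
  have e := listSign_mul_self (θ.psi ∘ d) l'
  unfold SignedProdRel
  convert this using 1
  calc _ = s * t * (listSign (θ.psi ∘ d) l * listSign (θ.psi ∘ d) l'') * 1 := (mul_one _).symm
    _ = _ := by
      rw [← e]
      ac_rfl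

theorem append (h : SignedProdRel 𝒜 θ d l l' s) (h' : SignedProdRel 𝒜 θ d m m' t)
    (hl : l.Perm l') (hm : m.Perm m') : SignedProdRel 𝒜 θ d (l ++ m) (l' ++ m') (s * t) := by
  have := ProdRel.append h h'
  have e := crossSign_mul_self (θ.psi ∘ d) l' m'
  unfold SignedProdRel
  convert this using 1
  rw [listSign_append, listSign_append, crossSign_perm _ hl hm]
  calc _ = s * (listSign (θ.psi ∘ d) l * listSign (θ.psi ∘ d) l') *
      (t * (listSign (θ.psi ∘ d) m * listSign (θ.psi ∘ d) m')) *
      (crossSign (θ.psi ∘ d) l' m' * crossSign (θ.psi ∘ d) l' m') := by ac_rfl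
    _ = _ := by rw [e, mul_one]

theorem cons (x : ι) (h : SignedProdRel 𝒜 θ d l l' t) (hl : l.Perm l') :
    SignedProdRel 𝒜 θ d (x :: l) (x :: l') t := by
  simpa using (refl 𝒜 θ d [x]).append h (List.Perm.refl _) hl

end SignedProdRel

namespace IsRegularGrading

variable {𝒜 : G → Submodule F A} {θ : CommFun G F}

theorem signedProdRel_unique {ι : Type*} [LinearOrder ι] (hreg : IsRegularGrading 𝒜 θ) {d : ι → G}
    {l l' : List ι} (hl' : l'.Nodup) {s t : Fˣ} (hs : SignedProdRel 𝒜 θ d l l' s)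
    (ht : SignedProdRel 𝒜 θ d l l' t) : s = t :=
  mul_right_cancel (hreg.prodRel_unique hl' hs ht)

/-- The exchange costs `ψ(g)`, and its Grassmann sign is `τ(ψ(g), ψ(g)) = ψ(g)`, so nothing is left
after the correction. -/
theorem signedProdRel_swap {ι : Type*} [LinearOrder ι] (hreg : IsRegularGrading 𝒜 θ) {d : ι → G}
    {x y : ι} {m : List ι} (hnd : (x :: (m ++ [y])).Nodup) (h : d x = d y) :
    SignedProdRel 𝒜 θ d (x :: (m ++ [y])) (y :: (m ++ [x])) 1 := by
  have hu : (θ.psi ∘ d) x = (θ.psi ∘ d) y := congrArg θ.psi h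
  rw [SignedProdRel, listSign_swap_mul _ hnd hu, ← hu, one_mul, Function.comp_apply,
    grassmannPair_self (hreg.psi_mul_self _)]
  exact hreg.prodRel_swap hnd h

/-- Permuting labels without changing the word of degrees does not change signed products. -/
theorem signedProdRel_of_map_eq {ι : Type*} [LinearOrder ι] (hreg : IsRegularGrading 𝒜 θ)
    {d : ι → G} {l : List ι} : ∀ {l' : List ι}, l.Nodup → l.Perm l' → l.map d = l'.map d →
      SignedProdRel 𝒜 θ d l l' 1 := by
  induction h : l.length generalizing l with
  | zero =>
    obtain rfl := List.length_eq_zero_iff.1 h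
    intro l' _ hp _
    obtain rfl := hp.nil_eq
    exact SignedProdRel.refl _ _ _ _
  | succ n ih =>
    intro l' hnd hp hd
    obtain ⟨x, m, rfl⟩ := List.exists_cons_of_length_eq_add_one h
    obtain ⟨y, m', rfl⟩ := List.exists_cons_of_length_eq_add_one (hp.length_eq ▸ h)
    simp only [List.map_cons, List.cons.injEq] at hd
    simp only [List.length_cons, add_left_inj] at h
    by_cases hxy : x = y
    · subst hxy
      have hm := (List.perm_cons x).1 hp
      exact (ih h (List.nodup_cons.1 hnd).2 hm hd.2).cons x hm
    · have hy : y ∈ m := by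
        have := hp.symm.subset (List.mem_cons_self : y ∈ y :: m')
        rcases List.mem_cons.1 this with h | h
        · exact absurd h.symm hxy
        · exact h
      obtain ⟨p, q, rfl⟩ := List.append_of_mem hy
      have e1 : x :: (p ++ y :: q) = x :: (p ++ [y]) ++ q := by simp
      have e2 : y :: (p ++ x :: q) = y :: (p ++ [x]) ++ q := by simp
      have hsw : (x :: (p ++ [y])).Perm (y :: (p ++ [x])) :=
        ((List.perm_append_comm (l₁ := p) (l₂ := [y])).cons x).trans
          ((List.Perm.swap y x p).trans ((List.perm_append_comm (l₁ := [x]) (l₂ := p)).cons y))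
      -- Both heads have the same degree, so exchanging `x` with `y` puts the correct head in place
      -- for free; the tails are left to induction.
      have s1 : SignedProdRel 𝒜 θ d (x :: (p ++ y :: q)) (y :: (p ++ x :: q)) 1 := by
        rw [e1, e2]
        rw [e1] at hnd
        simpa using (hreg.signedProdRel_swap (List.nodup_append.1 hnd).1 hd.1).append
          (SignedProdRel.refl 𝒜 θ d q) hsw (List.Perm.refl _)
      have hp2 : (x :: (p ++ y :: q)).Perm (y :: (p ++ x :: q)) := by
        rw [e1, e2]
        exact hsw.append_right q
      have hm := (List.perm_cons y).1 (hp2.symm.trans hp)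
      have hnd2 := (List.nodup_cons.1 (hp2.nodup_iff.1 hnd)).2
      have s2 := ih (by simpa using h) hnd2 hm (by simpa [hd.1] using hd.2)
      simpa using s1.trans (s2.cons y hm)

end IsRegularGrading

theorem exists_perm_map_eq {α β : Type*} {d : α → β} {l : List α} {w : List β}
    (h : (l.map d).Perm w) : ∃ l', l.Perm l' ∧ l'.map d = w := by
  have : Relation.Comp (fun x y => x = List.map d y) List.Perm w l := by
    rw [List.eq_map_comp_perm]
    exact h.symm
  obtain ⟨l', h1, h2⟩ := this
  exact ⟨l', h2.symm, h1.symm⟩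

theorem exists_nodup_map_eq {α : Type*} [Nonempty α] (w : List α) :
    ∃ (d : ℕ → α) (l : List ℕ), l.Nodup ∧ l.map d = w := by
  refine ⟨fun i => w.getD i (Classical.arbitrary α), List.range w.length, List.nodup_range, ?_⟩
  refine List.ext_get (by simp) fun i h1 h2 => ?_
  simp [List.getElem?_eq_getElem h2]

/-- The words `w` and `w'` in `G` are related by `t` if in the Grassmann envelope generic
monomials with degrees `w` are `t` times the permuted monomials with degrees `w'`. -/
structure WordRel (𝒜 : G → Submodule F A) (θ : CommFun G F) (w w' : List G) (t : Fˣ) : Prop where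
  perm : w.Perm w'
  prod_eq : w.prod = w'.prod
  signedProdRel : ∀ (d : ℕ → G) (l l' : List ℕ), l.Nodup → l.Perm l' → l.map d = w →
    l'.map d = w' → SignedProdRel 𝒜 θ d l l' t

namespace WordRel

variable {𝒜 : G → Submodule F A} {θ : CommFun G F} {u u' v v' w w' w'' : List G} {s t : Fˣ}

theorem refl (hreg : IsRegularGrading 𝒜 θ) (w : List G) : WordRel 𝒜 θ w w 1 :=
  ⟨List.Perm.refl _, rfl, fun _ _ _ hnd hp h h' =>
    hreg.signedProdRel_of_map_eq hnd hp (h.trans h'.symm)⟩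

theorem symm (h : WordRel 𝒜 θ w w' t) : WordRel 𝒜 θ w' w t⁻¹ :=
  ⟨h.perm.symm, h.prod_eq.symm, fun d l l' hnd hp hl hl' =>
    (h.signedProdRel d l' l (hp.nodup_iff.1 hnd) hp.symm hl' hl).symm⟩

theorem trans (h : WordRel 𝒜 θ w w' s) (h' : WordRel 𝒜 θ w' w'' t) :
    WordRel 𝒜 θ w w'' (s * t) := by
  refine ⟨h.perm.trans h'.perm, h.prod_eq.trans h'.prod_eq, fun d l l'' hnd hp hl hl'' => ?_⟩
  obtain ⟨l', h1, h2⟩ := exists_perm_map_eq (d := d) (l := l) (w := w') (hl ▸ h.perm)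
  exact (h.signedProdRel d l l' hnd h1 hl h2).trans
    (h'.signedProdRel d l' l'' (h1.nodup_iff.1 hnd) (h1.symm.trans hp) h2 hl'')

theorem append (hreg : IsRegularGrading 𝒜 θ) (h : WordRel 𝒜 θ u u' s) (h' : WordRel 𝒜 θ v v' t) :
    WordRel 𝒜 θ (u ++ v) (u' ++ v') (s * t) := by
  refine ⟨h.perm.append h'.perm, by rw [List.prod_append, List.prod_append, h.prod_eq, h'.prod_eq],
    fun d l l' hnd hp hl hl' => ?_⟩
  obtain ⟨l₁, l₂, rfl, h1, h2⟩ := List.map_eq_append_iff.1 hl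
  obtain ⟨m₁, hp1, hm1⟩ := exists_perm_map_eq (d := d) (l := l₁) (w := u') (h1 ▸ h.perm)
  obtain ⟨m₂, hp2, hm2⟩ := exists_perm_map_eq (d := d) (l := l₂) (w := v') (h2 ▸ h'.perm)
  have hnd' := List.nodup_append.1 hnd
  have e1 := (h.signedProdRel d l₁ m₁ hnd'.1 hp1 h1 hm1).append
    (h'.signedProdRel d l₂ m₂ hnd'.2.1 hp2 h2 hm2) hp1 hp2
  have hpp := hp1.append hp2
  -- The given `l'` may distribute labels differently from `m₁ ++ m₂`, but it spells the same word,
  -- so the correction is `1`.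
  have e2 := hreg.signedProdRel_of_map_eq (d := d) (hpp.nodup_iff.1 hnd) (hpp.symm.trans hp)
    (by rw [hl', List.map_append, hm1, hm2])
  simpa using e1.trans e2

theorem unique (hreg : IsRegularGrading 𝒜 θ) (h : WordRel 𝒜 θ w w' s) (h' : WordRel 𝒜 θ w w' t) :
    s = t := by
  obtain ⟨d, l, hnd, hl⟩ := exists_nodup_map_eq w
  obtain ⟨l', hp, hl'⟩ := exists_perm_map_eq (d := d) (l := l) (w := w') (hl ▸ h.perm)
  exact hreg.signedProdRel_unique (hp.nodup_iff.1 hnd)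
    (h.signedProdRel d l l' hnd hp hl hl') (h'.signedProdRel d l l' hnd hp hl hl')

end WordRel

namespace IsRegularGrading

variable {𝒜 : G → Submodule F A} {θ : CommFun G F}

theorem psi_one (hreg : IsRegularGrading 𝒜 θ) : θ.psi (1 : G) = 1 := by
  have := hreg.psi_mul 1 1
  rw [mul_one] at this
  exact mul_eq_left.1 this.symm

theorem prod_map_grassmannPair_psi (hreg : IsRegularGrading 𝒜 θ) (v : Fˣ) (w : List G) :
    (w.map fun g => grassmannPair (θ.psi g) v).prod = grassmannPair (θ.psi w.prod) v := by
  induction w with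
  | nil => simp [hreg.psi_one, grassmannPair_one_left]
  | cons g w ih =>
    rw [List.map_cons, List.prod_cons, ih, List.prod_cons, hreg.psi_mul,
      grassmannPair_mul_left (hreg.psi_mul_self _) (hreg.psi_mul_self _)]

/-- Words with product `1` are central. -/
theorem wordRel_comm_of_prod_eq_one (hreg : IsRegularGrading 𝒜 θ) {u : List G} (hu : u.prod = 1)
    (v : List G) : WordRel 𝒜 θ (u ++ v) (v ++ u) 1 := by
  refine ⟨List.perm_append_comm, by simp [hu], fun d l l' hnd hp hl hl' => ?_⟩
  obtain ⟨l₁, l₂, rfl, h1, h2⟩ := List.map_eq_append_iff.1 hl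
  have hpp : (l₁ ++ l₂).Perm (l₂ ++ l₁) := List.perm_append_comm
  have e2 := hreg.signedProdRel_of_map_eq (d := d) (hpp.nodup_iff.1 hnd) (hpp.symm.trans hp)
    (by rw [hl', List.map_append, h1, h2])
  have e1 : SignedProdRel 𝒜 θ d (l₁ ++ l₂) (l₂ ++ l₁) 1 := by
    -- For each `y` in `l₂` the sign of crossing `l₁` is `τ(ψ(∏ l₁), ψ(d y))`, by multiplicativity,
    -- and `ψ(1) = 1`.
    have hS : listSign (θ.psi ∘ d) (l₁ ++ l₂) * listSign (θ.psi ∘ d) (l₂ ++ l₁) = 1 := by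
      have hc := crossSign_mul_swap (θ.psi ∘ d) (l := l₁) (l' := l₂) fun x hx y hy =>
        (List.nodup_append.1 hnd).2.2 x hx y hy
      rw [list_prod_map_comm] at hc
      have hz : ∀ y, (l₁.map fun x => grassmannPair ((θ.psi ∘ d) x) ((θ.psi ∘ d) y)).prod = 1 := by
        intro y
        have := hreg.prod_map_grassmannPair_psi ((θ.psi ∘ d) y) (l₁.map d)
        rw [h1, hu, hreg.psi_one, grassmannPair_one_left, ← h1, List.map_map] at this
        exact this
      simp only [hz] at hc
      rw [listSign_append, listSign_append]
      calc _ = (listSign (θ.psi ∘ d) l₁ * listSign (θ.psi ∘ d) l₁) *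
            (listSign (θ.psi ∘ d) l₂ * listSign (θ.psi ∘ d) l₂) *
            (crossSign (θ.psi ∘ d) l₁ l₂ * crossSign (θ.psi ∘ d) l₂ l₁) := by ac_rfl
        _ = _ := by rw [hc, listSign_mul_self, listSign_mul_self]; simp
    rw [SignedProdRel, hS, one_mul]
    exact hreg.prodRel_comm_of_prod_eq_one (h1 ▸ hu) l₂
  simpa using e1.trans e2

theorem wordRel_ofFn (hreg : IsRegularGrading 𝒜 θ) {n : ℕ} (g : Fin (n + 1) → G)
    (σ : Equiv.Perm (Fin (n + 1))) (hσ : IsSym g σ) :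
    WordRel 𝒜 θ (List.ofFn g) (List.ofFn (g ∘ σ)) (θ.grassmannTwist n g σ) := by
  refine ⟨(σ.ofFn_comp_perm g).symm, ?_, fun d l l' hnd hp hl hl' => ?_⟩
  · rw [list_prod_ofFn_eq_tupleProd, list_prod_ofFn_eq_tupleProd]
    exact hσ
  have hlen : l.length = n + 1 := by simpa using congrArg List.length hl
  obtain ⟨f, rfl⟩ : ∃ f : Fin (n + 1) → ℕ, l = List.ofFn f :=
    ⟨fun i => l.get (finCongr hlen.symm i),
      List.ext_get (by simp [hlen]) fun i h1 h2 => by simp only [List.get_ofFn]; rfl⟩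
  have hf : d ∘ f = g := by
    rw [List.map_ofFn] at hl
    exact List.ofFn_injective hl
  have e1 := hreg.prodRel_ofFn d f σ (by rwa [hf])
  have hpp : (List.ofFn f).Perm (List.ofFn (f ∘ σ)) := (σ.ofFn_comp_perm f).symm
  have e2 := hreg.signedProdRel_of_map_eq (d := d) (hpp.nodup_iff.1 hnd) (hpp.symm.trans hp)
    (by rw [hl', List.map_ofFn, ← hf, Function.comp_assoc])
  have e3 : SignedProdRel 𝒜 θ d (List.ofFn f) (List.ofFn (f ∘ σ)) (θ.grassmannTwist n g σ) := by
    -- The labels `f` need not be increasing, whereas `grassmannTuple` counts inversions of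
    -- positions.
    have hS := listSign_map_mul (θ.psi ∘ d) (f := f) (l := List.ofFn id) (l' := List.ofFn σ)
      (by simpa using! (σ.ofFn_comp_perm id).symm) (by rw [List.map_ofFn]; exact hnd)
    rw [List.map_ofFn, List.map_ofFn, Function.comp_id, listSign_finRange, one_mul,
      listSign_ofFn_perm] at hS
    have hq : grassmannTuple ((θ.psi ∘ d) ∘ f) σ * grassmannTuple ((θ.psi ∘ d) ∘ f) σ = 1 := by
      rw [← listSign_ofFn_perm]
      exact listSign_mul_self _ _
    have hg : θ.grassmannTwist n g σ = grassmannTuple ((θ.psi ∘ d) ∘ f) σ * θ n (d ∘ f) σ := by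
      rw [Function.comp_assoc, hf]
      rfl
    rw [SignedProdRel, hS, hg, mul_right_comm, hq, one_mul]
    exact e1
  simpa using e3.trans e2

end IsRegularGrading

end Words

/-! ### Splitting off the scalars -/

section Divisible

/-- Over an algebraically closed field `Fˣ` is divisible, so it is a retract of every commutative
group that contains it. -/
theorem exists_retraction_units {F E : Type*} [Field F] [IsAlgClosed F] [CommGroup E]
    (i : Fˣ →* E) (hi : Function.Injective i) : ∃ r : E →* Fˣ, ∀ x, r (i x) = x := by
  have hs : ∀ {n : ℕ}, n ≠ 0 → Function.Surjective fun a : Additive Fˣ => n • a := by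
    intro n hn a
    obtain ⟨z, hz⟩ := IsAlgClosed.exists_pow_nat_eq ((Additive.toMul a : Fˣ) : F)
      (Nat.pos_of_ne_zero hn)
    have hz0 : z ≠ 0 := by
      rintro rfl
      rw [zero_pow hn] at hz
      exact (Additive.toMul a : Fˣ).ne_zero hz.symm
    refine ⟨Additive.ofMul (Units.mk0 z hz0), ?_⟩
    apply Additive.toMul.injective
    ext
    simpa using hz
  let _ : DivisibleBy (Additive Fˣ) ℕ := divisibleByOfSMulRightSurj _ _ hs
  let _ : DivisibleBy (Additive Fˣ) ℤ := AddGroup.divisibleByIntOfDivisibleByNat _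
  obtain ⟨r, hr⟩ := (Module.Baer.of_divisible (Additive Fˣ)).extension_property_addMonoidHom
    (MonoidHom.toAdditive i) hi (AddMonoidHom.id _)
  exact ⟨MonoidHom.toAdditive.symm r, fun x => DFunLike.congr_fun hr (Additive.ofMul x)⟩

end Divisible

/-! ### From trivial words to a cocycle -/

section Weights

variable {G F A : Type*} [Group G] [DecidableEq G] [Field F] [NonUnitalRing A] [Module F A]
  [IsScalarTower F A A] [SMulCommClass F A A] {𝒜 : G → Submodule F A} {θ : CommFun G F}

variable (G) in
/-- The words in `G` with product `1`. -/
abbrev TrivialWords : Submonoid (FreeMonoid G) := MonoidHom.mker (FreeMonoid.lift (id : G → G))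

theorem TrivialWords.prod_toList (w : TrivialWords G) : w.1.toList.prod = 1 := by
  have := w.2
  rw [MonoidHom.mem_mker, FreeMonoid.lift_apply, List.map_id] at this
  exact this

/-- Scalar multiples of words with product `1`, up to permutation of the words. -/
def wordCon (hreg : IsRegularGrading 𝒜 θ) : Con (Fˣ × TrivialWords G) where
  r p q := ∃ t, WordRel 𝒜 θ p.2.1.toList q.2.1.toList t ∧ q.1 = p.1 * t
  iseqv :=
    { refl := fun p => ⟨1, WordRel.refl hreg _, (mul_one _).symm⟩
      symm := fun ⟨t, h, e⟩ => ⟨t⁻¹, h.symm, by rw [e, mul_inv_cancel_right]⟩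
      trans := fun ⟨s, h, e⟩ ⟨t, h', e'⟩ => ⟨s * t, h.trans h', by rw [e', e, mul_assoc]⟩ }
  mul' := fun ⟨s, h, e⟩ ⟨t, h', e'⟩ =>
    ⟨s * t, h.append hreg h', by rw [Prod.fst_mul, Prod.fst_mul, e, e', mul_mul_mul_comm]⟩

/-- Commutativity is the centrality of trivial words; it is what allows passage to the Grothendieck
group. -/
noncomputable instance (hreg : IsRegularGrading 𝒜 θ) : CommMonoid (wordCon hreg).Quotient where
  mul_comm x y := by
    induction x, y using Con.induction_on₂ with
    | _ p q =>
      exact (wordCon hreg).eq.2 ⟨1, hreg.wordRel_comm_of_prod_eq_one (TrivialWords.prod_toList p.2) _,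
        by rw [mul_one, Prod.fst_mul, Prod.fst_mul, mul_comm]⟩

/-- A character of the words with product `1` that is compatible with permutations. -/
theorem IsRegularGrading.exists_wordCharacter [IsAlgClosed F] (hreg : IsRegularGrading 𝒜 θ) :
    ∃ χ : List G → Fˣ, (∀ u v : List G, u.prod = 1 → v.prod = 1 → χ (u ++ v) = χ u * χ v) ∧
      ∀ (w w' : List G) (t : Fˣ), WordRel 𝒜 θ w w' t → w.prod = 1 → χ w = t * χ w' := by
  let i₀ : Fˣ →* (wordCon hreg).Quotient := (wordCon hreg).mk'.comp (MonoidHom.inl _ _)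
  let i : Fˣ →* Algebra.GrothendieckGroup (wordCon hreg).Quotient :=
    Algebra.GrothendieckGroup.of.comp i₀
  -- Equality in the localization holds after multiplication by some class `c`. Cancelling the
  -- scalar of `c` leaves a relation of a word with itself, whose scalar is `1` by uniqueness.
  have hi : Function.Injective i := by
    intro a b hab
    obtain ⟨c, hc⟩ := (Localization.monoidOf
      (⊤ : Submonoid (wordCon hreg).Quotient)).eq_iff_exists.1 hab
    obtain ⟨c, hcm⟩ := c
    obtain ⟨p, rfl⟩ := (wordCon hreg).mk'_surjective c
    obtain ⟨t, ht, e⟩ := (wordCon hreg).eq.1 hc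
    have h1 : t = 1 := by
      have : WordRel 𝒜 θ (p.2.1.toList ++ []) (p.2.1.toList ++ []) t := ht
      exact this.unique hreg (WordRel.refl hreg _)
    rw [h1, mul_one] at e
    exact (mul_left_cancel (e : p.1 * b = p.1 * a)).symm
  obtain ⟨r, hr⟩ := exists_retraction_units i hi
  have hmem : ∀ w : List G, w.prod = 1 → FreeMonoid.ofList w ∈ TrivialWords G := by
    intro w hw
    rw [MonoidHom.mem_mker, FreeMonoid.lift_apply, List.map_id]
    exact hw
  let c : (w : List G) → w.prod = 1 → (wordCon hreg).Quotient := fun w hw =>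
    (wordCon hreg).mk' (1, ⟨FreeMonoid.ofList w, hmem w hw⟩)
  let χ : List G → Fˣ := fun w =>
    if hw : w.prod = 1 then r (Algebra.GrothendieckGroup.of (c w hw)) else 1
  refine ⟨χ, fun u v hu hv => ?_, fun w w' t h hw => ?_⟩
  · have huv : (u ++ v).prod = 1 := by simp [hu, hv]
    simp only [χ, dif_pos hu, dif_pos hv, dif_pos huv]
    rw [← map_mul, ← map_mul]
    congr 2
    exact (wordCon hreg).eq.2 ⟨1, WordRel.refl hreg _, by simp⟩
  · have hw' : w'.prod = 1 := h.prod_eq ▸ hw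
    have e : c w hw = i₀ t * c w' hw' :=
      (wordCon hreg).eq.2 ⟨t, h, by simp⟩
    simp only [χ, dif_pos hw, dif_pos hw']
    rw [e, map_mul, map_mul]
    congr 1
    exact hr t

/-- A cocycle together with the scalars by which the products `U_{g₁} ⋯ U_{gₙ}` differ from
`U_{g₁ ⋯ gₙ}`. -/
theorem IsRegularGrading.exists_cocycle_weight [IsAlgClosed F] (hreg : IsRegularGrading 𝒜 θ) :
    ∃ (α : TwoCocycle G F) (c : List G → Fˣ), (∀ g, c [g] = 1) ∧
      (∀ g w, c (g :: w) = α.toFun g w.prod * c w) ∧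
      ∀ (w w' : List G) (t : Fˣ), WordRel 𝒜 θ w w' t → c w = t * c w' := by
  obtain ⟨χ, hmul, hrel⟩ := hreg.exists_wordCharacter
  -- A trivial factor moves to the front at no cost, and `χ` is multiplicative there.
  have hins : ∀ u w v : List G, w.prod = 1 → (u ++ v).prod = 1 →
      χ (u ++ w ++ v) = χ w * χ (u ++ v) := by
    intro u w v hw huv
    have h1 := (hreg.wordRel_comm_of_prod_eq_one hw u).symm.append hreg (WordRel.refl hreg v)
    rw [inv_one, one_mul] at h1
    rw [hrel _ _ _ h1 (by simpa [hw] using huv), one_mul, List.append_assoc, hmul _ _ hw huv]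
  have hinv : ∀ x : G, χ [x⁻¹, x] = χ [x, x⁻¹] := by
    intro x
    have h1 := hmul [x, x⁻¹] [x, x⁻¹] (by simp) (by simp)
    have h2 := hins [x] [x⁻¹, x] [x⁻¹] (by simp) (by simp)
    exact mul_right_cancel (h2.symm.trans h1)
  -- Closing `w` by the inverse of its product makes it trivial; the denominator normalizes `c [g] =
  -- 1`.
  let c : List G → Fˣ := fun w => χ (w ++ [w.prod⁻¹]) / χ [w.prod, w.prod⁻¹]
  -- With `p` the product of `w`, read `g w p⁻¹ p (gp)⁻¹` in two ways: as `w p⁻¹` inserted into `g p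
  -- (gp)⁻¹`, and as `p⁻¹ p` inserted into `g w (gp)⁻¹`.
  have hleft : ∀ g w, c (g :: w) = c [g, w.prod] * c w := by
    intro g w
    have h1 := hins [g] (w ++ [w.prod⁻¹]) [w.prod, (g * w.prod)⁻¹] (by simp) (by simp)
    have h2 := hins (g :: w) [w.prod⁻¹, w.prod] [(g * w.prod)⁻¹] (by simp) (by simp)
    have h3 : χ (w ++ [w.prod⁻¹]) * χ [g, w.prod, (g * w.prod)⁻¹] =
        χ [w.prod, w.prod⁻¹] * χ (g :: w ++ [(g * w.prod)⁻¹]) := by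
      rw [← hinv w.prod]
      refine Eq.trans (h1.symm.trans ?_) h2
      simp
    simp only [c, List.prod_cons, List.prod_nil, mul_one, List.cons_append, List.nil_append] at h3 ⊢
    rw [div_mul_div_comm, div_eq_div_iff_mul_eq_mul, mul_comm (χ [g, w.prod, _]), h3]
    ac_rfl
  have hright : ∀ w k, c (w ++ [k]) = c w * c [w.prod, k] := by
    intro w k
    have h1 := hmul (w ++ [w.prod⁻¹]) [w.prod, k, (w.prod * k)⁻¹] (by simp) (by simp)
    have h2 := hins w [w.prod⁻¹, w.prod] [k, (w.prod * k)⁻¹] (by simp) (by simp [← mul_assoc])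
    have h3 : χ (w ++ [w.prod⁻¹]) * χ [w.prod, k, (w.prod * k)⁻¹] =
        χ [w.prod, w.prod⁻¹] * χ (w ++ [k, (w.prod * k)⁻¹]) := by
      rw [← hinv w.prod]
      refine Eq.trans (h1.symm.trans ?_) h2
      simp
    simp only [c, List.prod_cons, List.prod_nil, mul_one, List.cons_append, List.nil_append,
      List.prod_append, List.append_assoc] at h3 ⊢
    rw [div_mul_div_comm, div_eq_div_iff_mul_eq_mul, h3]
    ac_rfl
  refine ⟨⟨fun g h => c [g, h], fun g h k => ?_⟩, c, fun g => ?_, hleft, fun w w' t h => ?_⟩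
  -- The cocycle identity equates two factorizations of `c [g, h, k]`.
  · have h1 := hright [g, h] k
    have h2 := hleft g [h, k]
    simp only [List.prod_cons, List.prod_nil, mul_one, List.cons_append, List.nil_append] at h1 h2
    rw [← h1, h2, mul_comm]
  · simp [c]
  · have h1 := h.append hreg (WordRel.refl hreg [w.prod⁻¹])
    simp only [c]
    rw [hrel _ _ _ h1 (by simp), mul_one, ← h.prod_eq, mul_div_assoc]

/-- The twisted group algebra of a suitable cocycle has commutation function `τθ`. -/
theorem IsRegularGrading.exists_isAssociatedCocycle [IsAlgClosed F]
    (hreg : IsRegularGrading 𝒜 θ) : ∃ α : TwoCocycle G F, IsAssociatedCocycle θ α := by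
  obtain ⟨α, c, hc1, hc, hrel⟩ := hreg.exists_cocycle_weight
  have hprod : ∀ (n : ℕ) (g : Fin (n + 1) → G) (b : Fin (n + 1) → F),
      tupleProd (fun i => b i • TwistedGroupAlgebra.U α (g i)) =
        ((∏ i, b i) * (c (List.ofFn g) : F)) • TwistedGroupAlgebra.U α (tupleProd g) := by
    intro n
    induction n with
    | zero =>
      intro g b
      simp [tupleProd, hc1]
    | succ n ih =>
      intro g b
      rw [tupleProd, ih (fun i => g i.succ) (fun i => b i.succ), List.ofFn_succ (f := g), hc,
        list_prod_ofFn_eq_tupleProd, Fin.prod_univ_succ b, smul_mul_smul_comm,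
        TwistedGroupAlgebra.U_mul_U, smul_smul, tupleProd, Units.val_mul]
      congr 1
      ring
  have hU : ∀ g, TwistedGroupAlgebra.U α g ≠ 0 := fun g => by
    rw [← TwistedGroupAlgebra.basisU_apply]
    exact (TwistedGroupAlgebra.basisU α).ne_zero g
  refine ⟨α, ?_, ?_, ?_, ?_⟩
  · refine DirectSum.isInternal_submodule_of_iSupIndep_of_iSup_eq_top
      (TwistedGroupAlgebra.basisU α).linearIndependent.iSupIndep_span_singleton ?_
    have := (TwistedGroupAlgebra.basisU α).span_eq
    rwa [Submodule.span_range_eq_iSup] at this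
  · intro g h a b ha hb
    obtain ⟨r, rfl⟩ := Submodule.mem_span_singleton.1 ha
    obtain ⟨s, rfl⟩ := Submodule.mem_span_singleton.1 hb
    rw [smul_mul_smul_comm, TwistedGroupAlgebra.U_mul_U]
    exact Submodule.smul_mem _ _ (Submodule.smul_mem _ _ (Submodule.mem_span_singleton_self _))
  · intro n g σ hσ a ha
    choose b hb using fun i => Submodule.mem_span_singleton.1 (ha i)
    obtain rfl : a = fun i => b i • TwistedGroupAlgebra.U α (g i) := funext fun i => (hb i).symm
    have h1 := hprod n (g ∘ σ) (b ∘ σ)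
    have hσ' : tupleProd (g ∘ σ) = tupleProd g := hσ.symm
    simp only [Function.comp_apply] at h1
    rw [h1, hprod, hσ', hrel _ _ _ (hreg.wordRel_ofFn g σ hσ), smul_smul, Equiv.prod_comp σ b,
      Units.val_mul]
    congr 1
    ring
  · intro n g
    refine ⟨fun i => TwistedGroupAlgebra.U α (g i),
      fun i => Submodule.mem_span_singleton_self _, ?_⟩
    have := hprod n g 1
    simp only [Pi.one_apply, one_smul, Finset.prod_const_one, one_mul] at this
    rw [this]
    exact smul_ne_zero (Units.ne_zero _) (hU _)

end Weights

/-! ### The square of the commutation matrix -/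

section CommutationMatrix

variable {G F A : Type*} [Group G] [DecidableEq G] [Field F] [NonUnitalRing A] [Module F A]
  [IsScalarTower F A A] [SMulCommClass F A A] {𝒜 : G → Submodule F A} {θ : CommFun G F}
  {α : TwoCocycle G F}

open TwistedGroupAlgebra

theorem CommFun.grassmannTwist_pair (θ : CommFun G F) (g h : G) :
    θ.grassmannTwist.pair g h = grassmannPair (θ.psi g) (θ.psi h) * θ.pair g h := by
  simp [CommFun.pair, CommFun.grassmannTwist, grassmannTuple, Fin.prod_univ_two, grassmannPair_comm]

theorem TwistedGroupAlgebra.unitU_mul (α : TwoCocycle G F) (g h : G) : unitU α g * unitU α h =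
    Units.map (algebraMap F (TwistedGroupAlgebra α)).toMonoidHom (α.toFun g h) *
      unitU α (g * h) := by
  ext
  exact (U_mul_U α g h).trans (Algebra.smul_def _ _)

theorem units_map_algebraMap_comm {B : Type*} [Ring B] [Algebra F B] (c : Fˣ) (w : Bˣ) :
    Units.map (algebraMap F B).toMonoidHom c * w = w * Units.map (algebraMap F B).toMonoidHom c :=
  Units.ext (Algebra.commutes _ _)

theorem IsAssociatedCocycle.unitU_mul_comm (hα : IsAssociatedCocycle θ α) {g h : G}
    (hgh : g * h = h * g) : unitU α g * unitU α h =
      Units.map (algebraMap F (TwistedGroupAlgebra α)).toMonoidHom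
        (grassmannPair (θ.psi g) (θ.psi h) * θ.pair g h) * (unitU α h * unitU α g) := by
  ext
  rw [← CommFun.grassmannTwist_pair]
  refine (IsRegularGrading.mul_eq_pair_smul hα hgh (Submodule.mem_span_singleton_self (U α g))
    (Submodule.mem_span_singleton_self (U α h))).trans (Algebra.smul_def _ _)

/-- Conjugation of `U_t` by `U_{hz}`, where `z` centralizes `t`. -/
theorem IsAssociatedCocycle.conj_unitU_mul (hα : IsAssociatedCocycle θ α) {z t : G} (h : G)
    (hzt : z * t = t * z) : unitU α (h * z) * unitU α t * (unitU α (h * z))⁻¹ =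
      Units.map (algebraMap F (TwistedGroupAlgebra α)).toMonoidHom
        (grassmannPair (θ.psi z) (θ.psi t) * θ.pair z t) *
        (unitU α h * unitU α t * (unitU α h)⁻¹) := by
  have h1 := unitU_mul α h z
  have h2 := hα.unitU_mul_comm hzt
  set c := Units.map (algebraMap F (TwistedGroupAlgebra α)).toMonoidHom (α.toFun h z)
  set q := Units.map (algebraMap F (TwistedGroupAlgebra α)).toMonoidHom
    (grassmannPair (θ.psi z) (θ.psi t) * θ.pair z t)
  have hc : ∀ w, c * w = w * c := units_map_algebraMap_comm _
  have hq : ∀ w, q * w = w * q := units_map_algebraMap_comm _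
  rw [mul_inv_eq_iff_eq_mul]
  apply mul_left_cancel (a := c)
  calc c * (unitU α (h * z) * unitU α t) = unitU α h * (unitU α z * unitU α t) := by
        rw [← mul_assoc, ← h1, mul_assoc]
    _ = q * (unitU α h * unitU α t * (unitU α h)⁻¹) * (unitU α h * unitU α z) := by
        rw [h2, ← mul_assoc, ← hq]
        group
    _ = _ := by
        rw [h1, ← mul_assoc, ← hc, mul_assoc]

/-- The twisted class sums of nontrivial elements vanish. -/
theorem sum_conj_unitU_eq_zero [Fintype G] (hreg : IsRegularGrading 𝒜 θ) (hnd : θ.Nondegenerate)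
    (hα : IsAssociatedCocycle θ α) {t : G} (ht : t ≠ 1) :
    ∑ h : G, (grassmannPair (θ.psi t) (θ.psi h) : F) •
      ((unitU α h * unitU α t * (unitU α h)⁻¹ : (TwistedGroupAlgebra α)ˣ) :
        TwistedGroupAlgebra α) = 0 := by
  obtain ⟨z, hz, hne⟩ := hnd t ht
  have hzt : z * t = t * z := (Subgroup.mem_centralizer_singleton_iff.1 hz)
  set E : G → TwistedGroupAlgebra α := fun h => (grassmannPair (θ.psi t) (θ.psi h) : F) •
      ((unitU α h * unitU α t * (unitU α h)⁻¹ : (TwistedGroupAlgebra α)ˣ) :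
        TwistedGroupAlgebra α) with hE
  have key : ∀ h, E (h * z) = (θ.pair z t : F) • E h := by
    intro h
    have hs : grassmannPair (θ.psi t) (θ.psi (h * z)) *
        (grassmannPair (θ.psi z) (θ.psi t) * θ.pair z t) =
        θ.pair z t * grassmannPair (θ.psi t) (θ.psi h) := by
      rw [hreg.psi_mul, grassmannPair_comm,
        grassmannPair_mul_left (hreg.psi_mul_self _) (hreg.psi_mul_self _)]
      calc _ = θ.pair z t * grassmannPair (θ.psi h) (θ.psi t) *
            (grassmannPair (θ.psi z) (θ.psi t) * grassmannPair (θ.psi z) (θ.psi t)) := by ac_rfl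
        _ = _ := by rw [grassmannPair_mul_self, mul_one, grassmannPair_comm (θ.psi h)]
    simp only [hE]
    rw [hα.conj_unitU_mul h hzt, Units.val_mul]
    change _ • (algebraMap F _ _ * _) = _
    rw [← Algebra.smul_def, smul_smul, smul_smul, ← Units.val_mul, ← Units.val_mul, hs]
  -- Right translation by `z` permutes `G`, so the sum is fixed by a scalar different from `1`.
  have hsum : ∑ h, E h = (θ.pair z t : F) • ∑ h, E h := by
    rw [Finset.smul_sum, ← Equiv.sum_comp (Equiv.mulRight z) E]
    exact Finset.sum_congr rfl fun h _ => key h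
  have hne' : (θ.pair z t : F) ≠ 1 := by
    intro h
    have h1 : θ.pair z t = 1 := Units.ext h
    have h2 := hreg.pair_mul_pair_swap hzt
    rw [h1, one_mul] at h2
    exact hne h2
  have h0 : ((θ.pair z t : F) - 1) • ∑ h, E h = 0 := by
    rw [sub_smul, one_smul, ← hsum, sub_self]
  exact (smul_eq_zero.1 h0).resolve_left (sub_ne_zero.2 hne')

theorem commutationMatrix_sq [Fintype G] (hreg : IsRegularGrading 𝒜 θ) (hnd : θ.Nondegenerate)
    (hα : IsAssociatedCocycle θ α) : commutationMatrix θ α ^ 2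
      = Fintype.card G • (1 : Matrix G G (TwistedGroupAlgebra α)) := by
  ext g k
  obtain ⟨t, rfl⟩ : ∃ t, k = g * t := ⟨g⁻¹ * k, by simp⟩
  -- The inner `U_h⁻¹ U_h` cancels and `U_g⁻¹ U_{gt} = α(g, t)⁻¹ U_t`. The signs combine to `τ(ψ(t),
  -- ψ(h))`, the `ψ(g)` contributions cancelling.
  have hentry : (commutationMatrix θ α ^ 2) g (g * t) =
      (unitU α g : TwistedGroupAlgebra α) * ((((α.toFun g t)⁻¹ : Fˣ) : F) •
        ∑ h : G, (grassmannPair (θ.psi t) (θ.psi h) : F) •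
          ((unitU α h * unitU α t * (unitU α h)⁻¹ : (TwistedGroupAlgebra α)ˣ) :
            TwistedGroupAlgebra α)) * ((unitU α (g * t))⁻¹ : (TwistedGroupAlgebra α)ˣ) := by
    rw [pow_two, Matrix.mul_apply, Finset.smul_sum, Finset.mul_sum, Finset.sum_mul]
    refine Finset.sum_congr rfl fun h _ => ?_
    have hs : grassmannPair (θ.psi g) (θ.psi h) * grassmannPair (θ.psi h) (θ.psi (g * t)) =
        grassmannPair (θ.psi t) (θ.psi h) := by
      rw [grassmannPair_comm (θ.psi h), hreg.psi_mul,
        grassmannPair_mul_left (hreg.psi_mul_self _) (hreg.psi_mul_self _), ← mul_assoc,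
        grassmannPair_mul_self, one_mul]
    have hu : unitU α g * unitU α h * (unitU α g)⁻¹ * (unitU α h)⁻¹ *
        (unitU α h * unitU α (g * t) * (unitU α h)⁻¹ * (unitU α (g * t))⁻¹) =
        Units.map (algebraMap F (TwistedGroupAlgebra α)).toMonoidHom (α.toFun g t)⁻¹ *
          (unitU α g * (unitU α h * unitU α t * (unitU α h)⁻¹) * (unitU α (g * t))⁻¹) := by
      have h1 := unitU_mul α g t
      rw [map_inv, eq_inv_mul_iff_mul_eq]
      have hc := units_map_algebraMap_comm (B := TwistedGroupAlgebra α) (α.toFun g t)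
      set c := Units.map (algebraMap F (TwistedGroupAlgebra α)).toMonoidHom (α.toFun g t)
      have h2 : unitU α (g * t) = unitU α g * unitU α t * c⁻¹ := by
        rw [h1, hc, mul_inv_cancel_right]
      have h3 : (unitU α g)⁻¹ * unitU α (g * t) = unitU α t * c⁻¹ := by
        rw [h2]
        group
      calc _ = c * (unitU α g * unitU α h * ((unitU α g)⁻¹ * unitU α (g * t)) *
            (unitU α h)⁻¹ * (unitU α (g * t))⁻¹) := by group
        _ = (c * (unitU α g * unitU α h * unitU α t)) * c⁻¹ *
            (unitU α h)⁻¹ * (unitU α (g * t))⁻¹ := by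
          rw [h3]
          group
        _ = _ := by
          rw [hc, mul_inv_cancel_right]
          group
    have hu' := congrArg (fun w : (TwistedGroupAlgebra α)ˣ => (w : TwistedGroupAlgebra α)) hu
    simp only [commutationMatrix]
    rw [smul_mul_smul_comm, ← Units.val_mul, ← Units.val_mul, hs, hu', Units.val_mul]
    change _ • (algebraMap F _ _ * _) = _
    rw [← Algebra.smul_def, smul_smul, smul_smul, mul_smul_comm, smul_mul_assoc, mul_comm]
    simp only [Units.val_mul]
  rw [hentry]
  rcases eq_or_ne t 1 with rfl | ht
  · have hone : unitU α 1 =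
        Units.map (algebraMap F (TwistedGroupAlgebra α)).toMonoidHom (α.toFun 1 1) := by
      have := unitU_mul α 1 1
      rw [mul_one] at this
      exact mul_right_cancel this
    have hterm : ∀ h, (grassmannPair (θ.psi 1) (θ.psi h) : F) •
        ((unitU α h * unitU α 1 * (unitU α h)⁻¹ : (TwistedGroupAlgebra α)ˣ) :
          TwistedGroupAlgebra α) = (α.toFun 1 1 : F) • 1 := by
      intro h
      rw [hone, ← units_map_algebraMap_comm, mul_inv_cancel_right, hreg.psi_one,
        grassmannPair_one_left, Units.val_one, one_smul]
      exact Algebra.algebraMap_eq_smul_one _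
    simp only [hterm, Finset.sum_const, Finset.card_univ]
    rw [α.one_right, smul_comm, smul_smul, ← Units.val_mul, inv_mul_cancel, Units.val_one, one_smul,
      mul_one, mul_smul_comm, mul_one, smul_mul_assoc, Units.mul_inv, Matrix.smul_apply,
      Matrix.one_apply_eq]
  · rw [sum_conj_unitU_eq_zero hreg hnd hα ht, smul_zero, mul_zero, zero_mul, Matrix.smul_apply,
      Matrix.one_apply_ne (by simpa using ht), smul_zero]

end CommutationMatrix

end RegularGrading

theorem mainTheorem3 {F : Type*} [Field F] [IsAlgClosed F] [CharZero F]
    {G : Type*} [Group G] [Fintype G] [DecidableEq G]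
    {A : Type*} [NonUnitalRing A] [Module F A] [IsScalarTower F A A] [SMulCommClass F A A]
    (𝒜 : G → Submodule F A) (θ : RegularGrading.CommFun G F)
    (hreg : RegularGrading.IsRegularGrading 𝒜 θ) (hnd : θ.Nondegenerate) :
    (∃ α : RegularGrading.TwoCocycle G F, RegularGrading.IsAssociatedCocycle θ α) ∧
    ∀ α : RegularGrading.TwoCocycle G F, RegularGrading.IsAssociatedCocycle θ α →
      RegularGrading.commutationMatrix θ α ^ 2
        = Fintype.card G • (1 : Matrix G G (RegularGrading.TwistedGroupAlgebra α)) :=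
  ⟨hreg.exists_isAssociatedCocycle, fun _ hα => RegularGrading.commutationMatrix_sq hreg hnd hα⟩
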